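/- Let $T$ be a complete first-order theory in a language $\mathcal L$ and let $\mathfrak C$ be a monster model of $T$ of monstrosity $\mu$: $\mu$ is a strong limit cardinal with $\mu > |T|$ (where $|T|=|\mathcal L|+\aleph_0$), and $\mathfrak C\models T$ is $\mu$-saturated and strongly $\mu$-homogeneous (every partial elementary map of $\mathfrak C$ whose domain has cardinality $<\mu$ extends to an automorphism). A set or a cardinal is *small* if its cardinality is $<\mu$. Let $ \perp$ be a symmetric independence relation on $\mathfrak C$, i.e. a ternary relation on small subsets of $\mathfrak C$ such that for all small $A,B,C,D$: - (Invariance) $A \perp_B C$ implies $\sigma(A) \perp_{\sigma(B)}\sigma(C)$ for every $\sigma\in\mathrm{Aut}(\mathfrak C)$; - (Normality) $A \perp_C B$ implies $A\cup C \perp_C B$; - (Symmetry) $A \perp_B C$ implies $C \perp_B A$; - (Transitivity) if $B\subseteq C\subseteq D$, then $A \perp_B D$ iff $A \perp_B C$ and $A \perp_C D$; - (Finite character) $A \perp_B C$ iff $A_0 \perp_B C$ for all finite $A_0\subseteq A$; - (Extension) there is $A'\equiv_B A$ with $A' \perp_B C$; - (Local character) there is a small cardinal $\kappa'$, not depending on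 $A$ and $C$, such that some $C_0\subseteq C$ satisfies $|C_0|<\kappa'+|A|^+$ and $A \perp_{C_0}C$. Let $\kappa_0$ be the smallest regular cardinal $\lambda$ such that for every finite tuple $a$ and every small $B$ there is $B_0\subseteq B$ with $|B_0|<\lambda$ and $a \perp_{B_0}B$. For small $A$ put $\mathrm{cl}(A)=\{c\in\mathfrak C: c \perp_A c\}$. A complete 1-type $q$ over a small set $A$ satisfies $q \perp_B A$ if some realization $c$ of $q$ in $\mathfrak C$ satisfies $c \perp_B A$. For a cardinal $\kappa$, a *$\kappa$-lovely pair* $M_P=(M,P(M))$ consists of a small elementary substructure $M\preceq\mathfrak C$ (so $M\models T$) and a subset $P(M)\subseteq M$ such that for every $A\subseteq M$ with $|A|<\kappa$ and every complete $\mathcal L$-1-type $q$ over $A$: - (Density) if $q \perp_{P(M)\cap A}A$, then $q$ is realized in $P(M)$; - (Extension) some $b\in M$ realizes $q$ and satisfies $b \perp_A P(M)$. Let $\kappa>\kappa_0$ be a small cardinal. Then: 1. $\kappa$-lovely pairs exist. 2. If $C\subseteq\mathfrak C$ is small and $P(C)\subseteq C$ is closed in $C$, i.e. $\mathrm{cl}(P(C))\cap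 C=P(C)$, then there is a $\kappa$-lovely pair $M_P$ extending $(C,P(C))$, i.e. $C\subseteq M$ and $P(M)\cap C=P(C)$, such that $P(M) \perp_{P(C)}C$. 3. For all small $A,B\subseteq\mathfrak C$ there is a $\kappa$-lovely pair $M_P$ such that $A\subseteq P(M)$ and $P(M) \perp_A B$. -/

import Mathlib

open FirstOrder Cardinal

universe u v w

namespace LovelyPairs

variable {L : FirstOrder.Language.{u, v}} {ℭ : Type w} [L.Structure ℭ]

/-- A subset of the monster model is small if its cardinality is smaller than the
monstrosity `μ`. -/
def IsSmall (μ : Cardinal.{w}) (A : Set ℭ) : Prop := #A < μ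

/-! ### Types -/

/-- The tuples `f` and `g` of elements of `ℭ`, indexed by the same set, have the same complete
`L`-type over the parameter set `B`. -/
def SameTypeOver (L : FirstOrder.Language.{u, v}) [L.Structure ℭ] (B : Set ℭ)
    {ι : Type w} (f g : ι → ℭ) : Prop :=
  ∀ φ : (L[[B]]).Formula ι, φ.Realize f ↔ φ.Realize g

/-- `A' ≡_B A` for sets: some bijection from `A` to `A'` sends an enumeration of `A` to a tuple
of the same type over `B`. -/
def SetEquivOver (L : FirstOrder.Language.{u, v}) [L.Structure ℭ] (B A A' : Set ℭ) : Prop :=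
  ∃ e : A ≃ A', SameTypeOver L B (fun a : A => (a : ℭ)) (fun a : A => (e a : ℭ))

/-- The space of complete `L`-1-types over the set `A` of parameters. -/
abbrev OneType (L : FirstOrder.Language.{u, v}) [L.Structure ℭ] (A : Set ℭ) :=
  ((L[[A]]).completeTheory ℭ).CompleteType (Fin 1)

/-- The element `b` of `ℭ` realizes the 1-type `q` over `A`. -/
def Realizes [Nonempty ℭ] (b : ℭ) {A : Set ℭ} (q : OneType L A) : Prop :=
  ((L[[A]]).completeTheory ℭ).typeOf (fun _ : Fin 1 => b) = q

/-! ### Monster models -/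

/-- `ℭ` is a monster model of `T` of monstrosity `μ`: it is a `μ`-saturated and strongly
`μ`-homogeneous model of `T`, where `μ` is a strong limit cardinal larger than `|T|`
(the number of `L`-formulas). -/
structure IsMonster (T : L.Theory) (μ : Cardinal.{w}) (ℭ : Type w) [L.Structure ℭ]
    [Nonempty ℭ] : Prop where
  model : ℭ ⊨ T
  isStrongLimit : μ.IsStrongLimit
  card_lt : max ℵ₀ (Cardinal.lift.{w} L.card) < Cardinal.lift.{max u v} μ
  saturated : ∀ A : Set ℭ, IsSmall μ A → ∀ q : OneType L A, ∃ b : ℭ, Realizes b q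
  homogeneous : ∀ (A : Set ℭ) (f : A → ℭ), IsSmall μ A →
    (∀ φ : L.Formula A, φ.Realize (fun a : A => (a : ℭ)) ↔ φ.Realize f) →
    ∃ σ : ℭ ≃[L] ℭ, ∀ a : A, σ a = f a

/-! ### Independence relations -/

/-- `Ind A B C` stands for `A ⫫_B C`. Only the values of `Ind` at small sets matter: `Ind` is a
symmetric independence relation on the small subsets of `ℭ`. -/
structure IsIndependenceRelation (L : FirstOrder.Language.{u, v}) [L.Structure ℭ]
    (μ : Cardinal.{w}) (Ind : Set ℭ → Set ℭ → Set ℭ → Prop) : Prop where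
  invariance : ∀ (σ : ℭ ≃[L] ℭ) (A B C : Set ℭ), IsSmall μ A → IsSmall μ B → IsSmall μ C →
    Ind A B C → Ind (σ '' A) (σ '' B) (σ '' C)
  normality : ∀ A B C : Set ℭ, IsSmall μ A → IsSmall μ B → IsSmall μ C →
    Ind A C B → Ind (A ∪ C) C B
  symmetry : ∀ A B C : Set ℭ, IsSmall μ A → IsSmall μ B → IsSmall μ C →
    Ind A B C → Ind C B A
  transitivity : ∀ A B C D : Set ℭ, IsSmall μ A → IsSmall μ B → IsSmall μ C → IsSmall μ D →
    B ⊆ C → C ⊆ D → (Ind A B D ↔ Ind A B C ∧ Ind A C D)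
  finite_character : ∀ A B C : Set ℭ, IsSmall μ A → IsSmall μ B → IsSmall μ C →
    (Ind A B C ↔ ∀ A₀ ⊆ A, A₀.Finite → Ind A₀ B C)
  extension : ∀ A B C : Set ℭ, IsSmall μ A → IsSmall μ B → IsSmall μ C →
    ∃ A' : Set ℭ, SetEquivOver L B A A' ∧ Ind A' B C
  local_character : ∃ κ : Cardinal.{w}, κ < μ ∧
    ∀ A C : Set ℭ, IsSmall μ A → IsSmall μ C →
      ∃ C₀ ⊆ C, #C₀ < κ + Order.succ #A ∧ Ind A C₀ C

/-- The cardinal `κ₀` of `Ind`: the smallest regular cardinal `κ` such that for every finite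
tuple `a` and every small set `B` there is `B₀ ⊆ B` with `|B₀| < κ` and `a ⫫_{B₀} B`. -/
noncomputable def kappaZero (μ : Cardinal.{w}) (Ind : Set ℭ → Set ℭ → Set ℭ → Prop) :
    Cardinal.{w} :=
  sInf {κ : Cardinal.{w} | κ.IsRegular ∧ ∀ A B : Set ℭ, A.Finite → IsSmall μ B →
    ∃ B₀ ⊆ B, #B₀ < κ ∧ Ind A B₀ B}

/-- The closure operator of `Ind` (on small sets): `c ∈ cl A` iff `c ⫫_A c`. -/
def cl (Ind : Set ℭ → Set ℭ → Set ℭ → Prop) (A : Set ℭ) : Set ℭ := {c | Ind {c} A {c}}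

/-- `X` is closed in `C`. -/
def IsClosedIn (Ind : Set ℭ → Set ℭ → Set ℭ → Prop) (X C : Set ℭ) : Prop := cl Ind X ∩ C = X

/-- `q ⫫_B A` for a complete 1-type `q` over `A`: some realization `c` of `q` in the monster
model satisfies `c ⫫_B A`. -/
def TypeIndep [Nonempty ℭ] (Ind : Set ℭ → Set ℭ → Set ℭ → Prop) {A : Set ℭ}
    (q : OneType L A) (B : Set ℭ) : Prop :=
  ∃ c : ℭ, Realizes c q ∧ Ind {c} B A

/-! ### Lovely pairs -/

/-- `(C, PC)` is an `L²`-substructure of `(M, PM)`, where `L² = L ∪ {P}`, all four sets are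
subsets of `ℭ`, and `C`, `M` carry the `L`-structure induced by `ℭ`: the interpretation of the
predicate `P` on `C` is the restriction of the one on `M`. -/
def IsSubpair (C PC M PM : Set ℭ) : Prop := C ⊆ M ∧ PM ∩ C = PC

/-- The pair `(M, P)`, where `M` is an elementary substructure of the monster model `ℭ` of `T`,
is a `κ`-lovely pair for `Ind` and `T`. -/
structure IsLovelyPair [Nonempty ℭ] (T : L.Theory) (μ : Cardinal.{w})
    (Ind : Set ℭ → Set ℭ → Set ℭ → Prop) (κ : Cardinal.{w})
    (M : L.ElementarySubstructure ℭ) (P : Set ℭ) : Prop where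
  pred_subset : P ⊆ (M : Set ℭ)
  model : M ⊨ T
  small : IsSmall μ (M : Set ℭ)
  density : ∀ A : Set ℭ, A ⊆ (M : Set ℭ) → #A < κ → ∀ q : OneType L A,
    TypeIndep Ind q (P ∩ A) → ∃ b ∈ P, Realizes b q
  extension : ∀ A : Set ℭ, A ⊆ (M : Set ℭ) → #A < κ → ∀ q : OneType L A,
    ∃ b ∈ M, Realizes b q ∧ Ind {b} A P

end LovelyPairs

/-!
A `κ`-lovely pair around `PC ⊆ C` is the union of a long increasing chain of pairs `(M i, P i)`
that starts with `(C, PC)` and satisfies `P j ⫫_{P i} M i` for `i ≤ j`. The union `P` of the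
predicates then satisfies `P ⫫_{P i} M i` for all `i`, by finite character; in particular
`P ⫫_{PC} C` (`IsIndependenceRelation.exists_isLovelyPair`). This contains all three assertions.
If `PC` is closed in `C`, then `c ∈ P ∩ C` gives `c ⫫_{PC} c`, so `c ∈ PC`; and the pair
`A ⊆ A ∪ B` yields `A ⊆ P` with `P ⫫_A B`.

In the step from `(M i, P i)` to the next pair (`IsIndependenceRelation.exists_step`), consider a
type `q` over `A ⊆ M i` with `|A| ≤ κ`. If `q ⫫_{P i ∩ A} A`, then `q` has a realization
independent over `A` from any given small set, and transitivity makes it independent over `P i`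
from `M i`. Choosing such realizations by well-founded recursion, each independent from the
preceding ones, makes their union independent from `M i` over `P i`, so that they can all be added
to the predicate. Next, every `q` receives a realization `b ∈ M (i + 1)` with
`b ⫫_A M i ∪ P (i + 1)`. As `P ⫫_{P (i + 1)} M (i + 1)`, this implies `b ⫫_A P`, which is the
extension condition. Density holds since `P ∩ A = P i ∩ A` for large `i`, the chain having
cofinality above `κ`. By the Tarski–Vaught test, the union is an elementary substructure.

Since `μ` may be singular, the sizes of the stages must be bounded uniformly: all of them have at
most `2 ^ ν` elements, where `ν = max (|L| + ℵ₀) κ |C|`. The step does not leave this bound because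
a set of size `2 ^ ν` has at most `2 ^ ν` subsets of size `≤ κ`, each with at most `2 ^ ν` types
(`IsMonster.exists_representatives`).

Types are handled through automorphisms: by strong homogeneity, elements with the
same type over a small set are conjugate over it.
-/

namespace LovelyPairs

open FirstOrder.Language

variable {L : FirstOrder.Language.{u, v}} {ℭ : Type w} [L.Structure ℭ]

/-! ### Small sets and conjugate elements -/

theorem IsSmall.mono {μ : Cardinal.{w}} {A B : Set ℭ} (hB : IsSmall μ B) (h : A ⊆ B) :
    IsSmall μ A :=
  (mk_le_mk_of_subset h).trans_lt hB

theorem IsSmall.union {μ : Cardinal.{w}} (hμ : ℵ₀ ≤ μ) {A B : Set ℭ} (hA : IsSmall μ A)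
    (hB : IsSmall μ B) : IsSmall μ (A ∪ B) :=
  (mk_union_le A B).trans_lt (add_lt_of_lt hμ hA hB)

theorem isSmall_of_finite {μ : Cardinal.{w}} (hμ : ℵ₀ ≤ μ) {A : Set ℭ} (hA : A.Finite) :
    IsSmall μ A :=
  hA.lt_aleph0.trans_le hμ

theorem isSmall_singleton {μ : Cardinal.{w}} (hμ : ℵ₀ ≤ μ) (a : ℭ) : IsSmall μ ({a} : Set ℭ) :=
  isSmall_of_finite hμ (Set.finite_singleton a)

/-- `b` and `c` are conjugate over `A`: an automorphism of `ℭ` fixing `A` pointwise sends `b`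
to `c`. In a monster model this says, for small `A`, that `b` and `c` have the same type
over `A`. -/
def Conj (L : FirstOrder.Language.{u, v}) [L.Structure ℭ] (A : Set ℭ) (b c : ℭ) : Prop :=
  ∃ σ : ℭ ≃[L] ℭ, (∀ a ∈ A, σ a = a) ∧ σ b = c

theorem Conj.symm {A : Set ℭ} {b c : ℭ} (h : Conj L A b c) : Conj L A c b := by
  obtain ⟨σ, hσ, rfl⟩ := h
  refine ⟨σ.symm, fun a ha => ?_, σ.symm_apply_apply b⟩
  conv_lhs => rw [← hσ a ha]
  exact σ.symm_apply_apply a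

theorem Conj.trans {A : Set ℭ} {b c d : ℭ} (h : Conj L A b c) (h' : Conj L A c d) :
    Conj L A b d := by
  obtain ⟨σ, hσ, rfl⟩ := h
  obtain ⟨τ, hτ, rfl⟩ := h'
  exact ⟨τ.comp σ, fun a ha => by simp [hσ a ha, hτ a ha], by simp⟩

/-! ### Types and automorphisms -/

theorem forall_realize_withConstants_iff {A : Set ℭ} {ι : Type*} (f g : ι → ℭ) :
    (∀ φ : L[[A]].Formula ι, φ.Realize f ↔ φ.Realize g) ↔
      ∀ φ : L.Formula (A ⊕ ι), φ.Realize (Sum.elim (fun a : A => (a : ℭ)) f) ↔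
        φ.Realize (Sum.elim (fun a : A => (a : ℭ)) g) := by
  have key : ∀ (ψ : L[[A]].Formula ι) (f : ι → ℭ),
      Formula.Realize (BoundedFormula.constantsVarsEquiv ψ)
        (Sum.elim (fun a : A => (a : ℭ)) f) ↔ ψ.Realize f := fun ψ f =>
    BoundedFormula.realize_constantsVarsEquiv (M := ℭ) (φ := ψ) (v := f)
  constructor
  · intro h φ
    have := h (BoundedFormula.constantsVarsEquiv.symm φ)
    rw [← key, ← key] at this
    rwa [Equiv.apply_symm_apply] at this
  · intro h φ
    rw [← key, ← key]
    exact h _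

/-- Strong homogeneity, for tuples with parameters: two short tuples with the same type over a
small set are conjugate over it. -/
theorem IsMonster.exists_equiv [Nonempty ℭ] {T : L.Theory} {μ : Cardinal.{w}}
    (hM : IsMonster T μ ℭ) {B : Set ℭ} (hB : IsSmall μ B) {ι : Type*} {f g : ι → ℭ}
    (hf : IsSmall μ (Set.range f))
    (h : ∀ φ : L.Formula (B ⊕ ι), φ.Realize (Sum.elim (fun b : B => (b : ℭ)) f) ↔
      φ.Realize (Sum.elim (fun b : B => (b : ℭ)) g)) :
    ∃ σ : ℭ ≃[L] ℭ, (∀ b ∈ B, σ b = b) ∧ ∀ i, σ (f i) = g i := by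
  set F : B ⊕ ι → ℭ := Sum.elim (fun b : B => (b : ℭ)) f with hF
  set G : B ⊕ ι → ℭ := Sum.elim (fun b : B => (b : ℭ)) g with hG
  -- A type records the equalities between the entries of a tuple and the parameters.
  have hFG : ∀ x y, F x = F y → G x = G y := fun x y hxy => by
    simpa [Formula.realize_equal] using (h (Term.equal (.var x) (.var y))).1
      (by simpa [Formula.realize_equal] using hxy)
  have hs : ∀ d : Set.range F, ∃ x, F x = d := fun d => d.2
  choose s hs using hs
  have hsmall : IsSmall μ (Set.range F) := by
    rw [hF, Set.Sum.elim_range, Subtype.range_coe]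
    exact hB.union hM.isStrongLimit.aleph0_le hf
  obtain ⟨σ, hσ⟩ := hM.homogeneous (Set.range F) (G ∘ s) hsmall fun φ => by
    have := h (φ.relabel s)
    rw [Formula.realize_relabel, Formula.realize_relabel] at this
    rwa [show F ∘ s = fun a : Set.range F => (a : ℭ) from funext hs] at this
  have key : ∀ x, σ (F x) = G x := fun x =>
    (hσ ⟨F x, x, rfl⟩).trans (hFG _ _ (hs _))
  exact ⟨σ, fun b hb => key (.inl ⟨b, hb⟩), fun i => key (.inr i)⟩

theorem Realizes.of_conj [Nonempty ℭ] {A : Set ℭ} {q : OneType L A} {b c : ℭ}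
    (hb : Realizes b q) (h : Conj L A b c) : Realizes c q := by
  obtain ⟨σ, hσ, rfl⟩ := h
  subst hb
  refine SetLike.ext fun φ => ?_
  obtain ⟨ψ, rfl⟩ := Formula.equivSentence.surjective φ
  rw [Theory.CompleteType.formula_mem_typeOf, Theory.CompleteType.formula_mem_typeOf]
  refine (forall_realize_withConstants_iff _ _).2 (fun φ => ?_) ψ
  conv_rhs => rw [← StrongHomClass.realize_formula σ φ]
  refine iff_of_eq (congrArg _ (funext ?_))
  rintro (a | i)
  · exact (hσ a a.2).symm
  · rfl

/-- There are at most `2 ^ ν` types over a set of size at most `ν ≥ |L| + ℵ₀`. -/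
theorem IsMonster.exists_representatives [Nonempty ℭ] {T : L.Theory} {μ : Cardinal.{w}}
    (hM : IsMonster T μ ℭ) {ν : Cardinal.{w}}
    (hν : max ℵ₀ (Cardinal.lift.{w} L.card) ≤ Cardinal.lift.{max u v} ν)
    {A : Set ℭ} (hA : IsSmall μ A) (hAν : #A ≤ ν) :
    ∃ R : Set ℭ, #R ≤ 2 ^ ν ∧ ∀ c, ∃ r ∈ R, Conj L A r c := by
  set tp : ℭ → Set (L.Formula (A ⊕ Fin 1)) := fun c =>
    {φ | φ.Realize (Sum.elim (fun a : A => (a : ℭ)) fun _ => c)}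
  have hs : ∀ p : Set.range tp, ∃ c, tp c = p := fun p => p.2
  choose s hs using hs
  have hν0 : ℵ₀ ≤ ν := by simpa using (le_max_left _ _).trans hν
  refine ⟨Set.range s, ?_, fun c => ⟨s ⟨tp c, c, rfl⟩, ⟨_, rfl⟩, ?_⟩⟩
  · have h1 : #(L.Formula (A ⊕ Fin 1)) ≤ Cardinal.lift.{max u v} ν := by
      have h2 : #(L.Formula (A ⊕ Fin 1)) ≤ #(Σ n, L.BoundedFormula (A ⊕ Fin 1) n) :=
        mk_le_of_injective (f := fun φ : L.Formula (A ⊕ Fin 1) =>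
          (⟨0, φ⟩ : Σ n, L.BoundedFormula (A ⊕ Fin 1) n)) fun φ ψ h => by simpa using h
      refine (h2.trans BoundedFormula.card_le).trans (max_le ((le_max_left _ _).trans hν) ?_)
      refine add_le_of_le (by simpa using hν0) ?_ ((le_max_right _ _).trans hν)
      refine Cardinal.lift_le.2 ?_
      simp only [mk_sum, Cardinal.lift_uzero, mk_fin, Nat.cast_one, Cardinal.lift_one]
      exact add_le_of_le hν0 hAν (one_le_aleph0.trans hν0)
    have h3 : Cardinal.lift.{max (max u v) w} #(Set.range s) ≤
        Cardinal.lift.{max (max u v) w} (2 ^ ν) := by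
      refine (mk_range_le_lift (f := s)).trans ?_
      rw [Cardinal.lift_two_power]
      refine (Cardinal.lift_le.2 (mk_set_le (Set.range tp))).trans ?_
      rw [mk_set, Cardinal.lift_two_power]
      refine power_le_power_left two_ne_zero ?_
      rw [Cardinal.lift_id'.{w, max (max u v) w}, Cardinal.lift_umax.{w, max u v}]
      exact h1
    exact Cardinal.lift_le.1 h3
  · obtain ⟨σ, hσ, hbc⟩ := hM.exists_equiv hA (f := fun _ : Fin 1 => s ⟨tp c, c, rfl⟩)
      (g := fun _ => c)
      (isSmall_of_finite hM.isStrongLimit.aleph0_le (Set.finite_range _))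
      fun φ => Set.ext_iff.1 (hs ⟨tp c, c, rfl⟩) φ
    exact ⟨σ, hσ, hbc 0⟩

/-! ### Calculus of independence -/

namespace IsIndependenceRelation

variable {μ : Cardinal.{w}} {Ind : Set ℭ → Set ℭ → Set ℭ → Prop}

theorem mono_left (hI : IsIndependenceRelation L μ Ind) {A A' B C : Set ℭ} (hA : IsSmall μ A)
    (hB : IsSmall μ B) (hC : IsSmall μ C) (h : Ind A B C) (hA' : A' ⊆ A) : Ind A' B C :=
  (hI.finite_character A' B C (hA.mono hA') hB hC).2 fun A₀ h₀ hfin =>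
    (hI.finite_character A B C hA hB hC).1 h A₀ (h₀.trans hA') hfin

theorem mono_right (hI : IsIndependenceRelation L μ Ind) {A B C C' : Set ℭ} (hA : IsSmall μ A)
    (hB : IsSmall μ B) (hC : IsSmall μ C) (h : Ind A B C) (hC' : C' ⊆ C) : Ind A B C' :=
  hI.symmetry _ _ _ (hC.mono hC') hB hA
    (hI.mono_left hC hB hA (hI.symmetry _ _ _ hA hB hC h) hC')

theorem union_base_right (hI : IsIndependenceRelation L μ Ind) (hμ : ℵ₀ ≤ μ) {A B C : Set ℭ}
    (hA : IsSmall μ A) (hB : IsSmall μ B) (hC : IsSmall μ C) (h : Ind A B C) :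
    Ind A B (C ∪ B) :=
  hI.symmetry _ _ _ (hC.union hμ hB) hB hA
    (hI.normality _ _ _ hC hA hB (hI.symmetry _ _ _ hA hB hC h))

theorem base_mono (hI : IsIndependenceRelation L μ Ind) (hμ : ℵ₀ ≤ μ) {A B B' C : Set ℭ}
    (hA : IsSmall μ A) (hB : IsSmall μ B) (hC : IsSmall μ C) (h : Ind A B C) (hBB' : B ⊆ B')
    (hB' : B' ⊆ C ∪ B) : Ind A B' C := by
  have hCB := hC.union hμ hB
  have h1 := ((hI.transitivity A B B' (C ∪ B) hA hB (hCB.mono hB') hCB hBB' hB').1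
    (hI.union_base_right hμ hA hB hC h)).2
  exact hI.mono_right hA (hCB.mono hB') hCB h1 Set.subset_union_left

theorem trans (hI : IsIndependenceRelation L μ Ind) (hμ : ℵ₀ ≤ μ) {A B C D : Set ℭ}
    (hA : IsSmall μ A) (hB : IsSmall μ B) (hC : IsSmall μ C) (hD : IsSmall μ D)
    (h : Ind A B C) (h' : Ind A (B ∪ C) D) : Ind A B (C ∪ D) := by
  have hBC := hB.union hμ hC
  have hDBC := hD.union hμ hBC
  have h1 := hI.union_base_right hμ hA hB hC h
  rw [Set.union_comm] at h1
  refine hI.mono_right hA hB hDBC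
    ((hI.transitivity A B (B ∪ C) (D ∪ (B ∪ C)) hA hB hBC hDBC Set.subset_union_left
      Set.subset_union_right).2 ⟨h1, hI.union_base_right hμ hA hBC hD h'⟩) ?_
  exact Set.union_subset (Set.subset_union_right.trans Set.subset_union_right)
    Set.subset_union_left

/-- The extension axiom, with the conjugate given by an automorphism. -/
theorem exists_equiv [Nonempty ℭ] {T : L.Theory} (hI : IsIndependenceRelation L μ Ind)
    (hM : IsMonster T μ ℭ) {A B C : Set ℭ} (hA : IsSmall μ A) (hB : IsSmall μ B)
    (hC : IsSmall μ C) :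
    ∃ σ : ℭ ≃[L] ℭ, (∀ b ∈ B, σ b = b) ∧ Ind (σ '' A) B C := by
  obtain ⟨A', ⟨e, he⟩, hA'⟩ := hI.extension A B C hA hB hC
  obtain ⟨σ, hσ, hσe⟩ := hM.exists_equiv hB (f := fun a : A => (a : ℭ))
    (g := fun a : A => (e a : ℭ)) (by rwa [Subtype.range_coe])
    ((forall_realize_withConstants_iff _ _).1 he)
  refine ⟨σ, hσ, ?_⟩
  convert hA' using 1
  ext x
  constructor
  · rintro ⟨a, ha, rfl⟩
    rw [hσe ⟨a, ha⟩]
    exact (e _).2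
  · intro hx
    refine ⟨e.symm ⟨x, hx⟩, (e.symm ⟨x, hx⟩).2, ?_⟩
    rw [hσe, e.apply_symm_apply]

theorem exists_conj [Nonempty ℭ] {T : L.Theory} (hI : IsIndependenceRelation L μ Ind)
    (hM : IsMonster T μ ℭ) (a : ℭ) {B C : Set ℭ} (hB : IsSmall μ B) (hC : IsSmall μ C) :
    ∃ b, Conj L B a b ∧ Ind {b} B C := by
  obtain ⟨σ, hσ, h⟩ := hI.exists_equiv hM (isSmall_singleton hM.isStrongLimit.aleph0_le a) hB hC
  exact ⟨σ a, ⟨σ, hσ, rfl⟩, by simpa using h⟩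

/-- Whether `b` is independent from `A` over a subset of `A` depends only on the type of `b`
over `A`. -/
theorem conj (hI : IsIndependenceRelation L μ Ind) (hμ : ℵ₀ ≤ μ) {A B : Set ℭ} {b c : ℭ}
    (hA : IsSmall μ A) (hBA : B ⊆ A) (h : Conj L A b c) (hb : Ind {b} B A) : Ind {c} B A := by
  obtain ⟨σ, hσ, rfl⟩ := h
  have hfix : ∀ S ⊆ A, σ '' S = S := fun S hS => by
    rw [Set.image_congr fun a ha => hσ a (hS ha), Set.image_id']
  simpa [hfix A subset_rfl, hfix B hBA] using
    hI.invariance σ {b} B A (isSmall_singleton hμ b) (hA.mono hBA) hA hb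

/-- Every set is independent from the base over the base. -/
theorem existence [Nonempty ℭ] {T : L.Theory} (hI : IsIndependenceRelation L μ Ind)
    (hM : IsMonster T μ ℭ) {A B : Set ℭ} (hA : IsSmall μ A) (hB : IsSmall μ B) : Ind A B B := by
  obtain ⟨σ, hσ, h⟩ := hI.exists_equiv hM hA hB hB
  have h' := hI.invariance σ.symm _ _ _ (mk_image_le.trans_lt hA) hB hB h
  have hfix : σ.symm '' B = B := by
    rw [Set.image_congr (g := id) fun b hb => ?_, Set.image_id]
    conv_lhs => rw [← hσ b hb]
    exact σ.symm_apply_apply b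
  rw [hfix, Set.image_image, Set.image_congr fun a _ => σ.symm_apply_apply a,
    Set.image_id'] at h'
  exact h'

end IsIndependenceRelation

/-! ### Realizing many types independently -/

namespace IsIndependenceRelation

variable {μ : Cardinal.{w}} {Ind : Set ℭ → Set ℭ → Set ℭ → Prop} [Nonempty ℭ] {T : L.Theory}

/-- A family of types `tp(a t / A t)` has realizations each of which is independent, over its own
parameters, from a prescribed set together with the preceding realizations. -/
theorem exists_sequence (hI : IsIndependenceRelation L μ Ind) (hM : IsMonster T μ ℭ)
    {ι : Type w} [LinearOrder ι] [WellFoundedLT ι] (hι : #ι < μ) {A : ι → Set ℭ} (a : ι → ℭ)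
    (hA : ∀ t, IsSmall μ (A t)) {M : Set ℭ} (hMs : IsSmall μ M) :
    ∃ f : ι → ℭ, ∀ t, Conj L (A t) (a t) (f t) ∧ Ind {f t} (A t) (M ∪ f '' Set.Iio t) := by
  have hμ := hM.isStrongLimit.aleph0_le
  have h : ∀ (t : ι) (X : Set ℭ), ∃ b, IsSmall μ X →
      Conj L (A t) (a t) b ∧ Ind {b} (A t) X := fun t X => by
    by_cases hX : IsSmall μ X
    · obtain ⟨b, hb⟩ := hI.exists_conj hM (a t) (hA t) hX
      exact ⟨b, fun _ => hb⟩
    · exact ⟨a t, fun h => absurd h hX⟩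
  choose g hg using h
  let F : (t : ι) → ((s : ι) → s < t → ℭ) → ℭ := fun t rec =>
    g t (M ∪ Set.range fun s : Set.Iio t => rec s s.2)
  refine ⟨wellFounded_lt.fix F, fun t => ?_⟩
  have key : wellFounded_lt.fix F t = g t (M ∪ wellFounded_lt.fix F '' Set.Iio t) := by
    rw [WellFounded.fix_eq, Set.image_eq_range]
  have hs : IsSmall μ (M ∪ wellFounded_lt.fix F '' Set.Iio t) :=
    hMs.union hμ ((mk_image_le.trans (mk_set_le _)).trans_lt hι)
  have := hg t _ hs
  rwa [← key] at this

/-- The range of a sequence, each term of which is independent from `M` and the preceding terms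
over `P ⊆ M`, is independent from `M` over `P`. -/
theorem range_of_sequence (hI : IsIndependenceRelation L μ Ind) (hM : IsMonster T μ ℭ)
    {ι : Type w} [LinearOrder ι] (hι : #ι < μ) {f : ι → ℭ} {M P : Set ℭ} (hMs : IsSmall μ M)
    (hPM : P ⊆ M) (hf : ∀ t, Ind {f t} P (M ∪ f '' Set.Iio t)) : Ind (Set.range f) P M := by
  have hμ := hM.isStrongLimit.aleph0_le
  have hPs := hMs.mono hPM
  have hfin : ∀ s : Finset ι, IsSmall μ (f '' s) := fun s =>
    isSmall_of_finite hμ (s.finite_toSet.image f)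
  have key : ∀ s : Finset ι, Ind (f '' s) P M := fun s => by
    induction s using Finset.induction_on_max with
    | empty =>
      obtain ⟨σ, -, h⟩ := hI.exists_equiv hM (isSmall_of_finite hμ Set.finite_empty) hPs hMs
      simpa using h
    | insert t s ht ih =>
      have hts := isSmall_singleton hμ (f t)
      have h1 : Ind {f t} P (M ∪ f '' s) :=
        hI.mono_right hts hPs (hMs.union hμ ((mk_image_le.trans (mk_set_le _)).trans_lt hι))
          (hf t) (Set.union_subset_union_right M (Set.image_mono fun x hx => ht x hx))
      have h2 : Ind {f t} (P ∪ f '' s) M :=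
        hI.mono_right hts (hPs.union hμ (hfin s)) (hMs.union hμ (hfin s))
          (hI.base_mono hμ hts hPs (hMs.union hμ (hfin s)) h1 Set.subset_union_left
            (Set.union_subset Set.subset_union_right
              (Set.subset_union_right.trans Set.subset_union_left))) Set.subset_union_left
      have h3 := hI.trans hμ hMs hPs (hfin s) hts (hI.symmetry _ _ _ (hfin s) hPs hMs ih)
        (hI.symmetry _ _ _ hts (hPs.union hμ (hfin s)) hMs h2)
      have h4 := hI.symmetry _ _ _ hMs hPs ((hfin s).union hμ hts) h3
      rwa [Finset.coe_insert, Set.image_insert_eq, Set.insert_eq, Set.union_comm]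
  refine (hI.finite_character _ _ _ (mk_range_le.trans_lt hι) hPs hMs).2 fun A₀ hA₀ hfinA => ?_
  obtain ⟨s, -, hs, rfl⟩ := Set.exists_subset_image_finite_and.1
    ⟨A₀, by rwa [Set.image_univ], hfinA, rfl⟩
  simpa using key hs.toFinset

/-- One step of the construction of a lovely pair: the pair `(M, P)` is enlarged to `(M', P')`,
without leaving the bound `2 ^ ν` on cardinalities, so that the density and extension conditions
hold for parameters in `M` and `P'` is independent from `M` over `P`. -/
theorem exists_step (hI : IsIndependenceRelation L μ Ind) (hM : IsMonster T μ ℭ)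
    {ν κ : Cardinal.{w}} (hν : max ℵ₀ (Cardinal.lift.{w} L.card) ≤ Cardinal.lift.{max u v} ν)
    (hκν : κ ≤ ν) (hνμ : 2 ^ ν < μ) {M P : Set ℭ} (hPM : P ⊆ M) (hMν : #M ≤ 2 ^ ν) :
    ∃ M' P' : Set ℭ, M ⊆ M' ∧ P ⊆ P' ∧ P' ⊆ M' ∧ #M' ≤ 2 ^ ν ∧ Ind P' P M ∧
      (∀ A ⊆ M, #A ≤ κ → ∀ c, Ind {c} (P ∩ A) A → ∃ b ∈ P', Conj L A c b) ∧
      (∀ A ⊆ M, #A ≤ κ → ∀ c, ∃ b ∈ M', Conj L A c b ∧ Ind {b} A (M ∪ P')) := by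
  have hμ := hM.isStrongLimit.aleph0_le
  have hν0 : ℵ₀ ≤ ν := by simpa using (le_max_left _ _).trans hν
  have hθ0 : ℵ₀ ≤ (2 : Cardinal.{w}) ^ ν := hν0.trans (cantor ν).le
  have hMs : IsSmall μ M := hMν.trans_lt hνμ
  have hPs := hMs.mono hPM
  have hR : ∀ A : {A : Set ℭ // A ⊆ M ∧ #A ≤ κ},
      ∃ R : Set ℭ, #R ≤ 2 ^ ν ∧ ∀ c, ∃ r ∈ R, Conj L A.1 r c := fun A =>
    hM.exists_representatives hν (hMs.mono A.2.1) (A.2.2.trans hκν)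
  choose R hRν hR using hR
  -- A task consists of parameters together with (a representative of) a type over them.
  let Task := Σ A : {A : Set ℭ // A ⊆ M ∧ #A ≤ κ}, R A
  have hTask : #Task ≤ 2 ^ ν := by
    have h1 : #{A : Set ℭ // A ⊆ M ∧ #A ≤ κ} ≤ 2 ^ ν := by
      refine (mk_bounded_subset_le M κ).trans ((power_le_power_right (max_le hMν hθ0)).trans ?_)
      rw [← power_mul]
      exact power_le_power_left two_ne_zero ((mul_le_mul' le_rfl hκν).trans (mul_eq_self hν0).le)
    rw [mk_sigma]
    refine (sum_le_sum _ (fun _ => 2 ^ ν) hRν).trans ?_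
    rw [sum_const']
    exact (mul_le_mul' h1 le_rfl).trans (mul_eq_self hθ0).le
  let DTask := {t : Task // Ind {t.2.1} (P ∩ t.1.1) t.1.1}
  have hDTask : #DTask ≤ 2 ^ ν := (mk_subtype_le _).trans hTask
  have hAs : ∀ t : Task, IsSmall μ t.1.1 := fun t => hMs.mono t.1.2.1
  obtain ⟨_, _⟩ := exists_wellFoundedLT DTask
  obtain ⟨f, hf⟩ := hI.exists_sequence hM (hDTask.trans_lt hνμ) (A := fun t : DTask => t.1.1.1)
    (fun t => t.1.2.1) (fun t => hAs t.1) hMs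
  have hfP : Ind (Set.range f) P M := by
    refine hI.range_of_sequence hM (hDTask.trans_lt hνμ) hMs hPM fun t => ?_
    have hfs := isSmall_singleton hμ (f t)
    have hIio : IsSmall μ (M ∪ f '' Set.Iio t) :=
      hMs.union hμ ((mk_image_le.trans (mk_set_le _)).trans_lt (hDTask.trans_lt hνμ))
    have hPA : IsSmall μ (P ∩ t.1.1.1) := hPs.mono Set.inter_subset_left
    have h1 := hI.conj hμ (hAs t.1) Set.inter_subset_right (hf t).1 t.2
    have h2 := hI.trans hμ hfs hPA (hAs t.1) hIio h1
      (by rw [Set.union_eq_self_of_subset_left Set.inter_subset_right]; exact (hf t).2)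
    rw [Set.union_eq_self_of_subset_left (t.1.1.2.1.trans Set.subset_union_left)] at h2
    exact hI.base_mono hμ hfs hPA hIio h2 Set.inter_subset_left
      (hPM.trans (Set.subset_union_left.trans Set.subset_union_left))
  have hfs : #(Set.range f) ≤ 2 ^ ν := mk_range_le.trans hDTask
  have hP's : IsSmall μ (P ∪ Set.range f) := hPs.union hμ (hfs.trans_lt hνμ)
  have hg : ∀ t : Task, ∃ b, Conj L t.1.1 t.2.1 b ∧ Ind {b} t.1.1 (M ∪ (P ∪ Set.range f)) :=
    fun t => hI.exists_conj hM _ (hAs t) (hMs.union hμ hP's)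
  choose g hg using hg
  refine ⟨M ∪ (Set.range f ∪ Set.range g), P ∪ Set.range f, Set.subset_union_left,
    Set.subset_union_left, Set.union_subset_union hPM Set.subset_union_left, ?_, ?_, ?_, ?_⟩
  · refine (mk_union_le _ _).trans (add_le_of_le hθ0 hMν ((mk_union_le _ _).trans
      (add_le_of_le hθ0 hfs (mk_range_le.trans hTask))))
  · rw [Set.union_comm]
    exact hI.normality _ _ _ (hfs.trans_lt hνμ) hMs hPs hfP
  · intro A hAM hAκ c hc
    obtain ⟨r, hr, hrc⟩ := hR ⟨A, hAM, hAκ⟩ c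
    have hrI : Ind {r} (P ∩ A) A :=
      hI.conj hμ (hMs.mono hAM) Set.inter_subset_right hrc.symm hc
    let t : DTask := ⟨⟨⟨A, hAM, hAκ⟩, ⟨r, hr⟩⟩, hrI⟩
    exact ⟨f t, .inr ⟨t, rfl⟩, hrc.symm.trans (hf t).1⟩
  · intro A hAM hAκ c
    obtain ⟨r, hr, hrc⟩ := hR ⟨A, hAM, hAκ⟩ c
    let t : Task := ⟨⟨A, hAM, hAκ⟩, ⟨r, hr⟩⟩
    exact ⟨g t, .inr (.inr ⟨t, rfl⟩), hrc.symm.trans (hg t).1, (hg t).2⟩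

end IsIndependenceRelation

/-! ### Existence of lovely pairs -/

/-- A set which realizes all types over its finite subsets is the universe of an elementary
substructure, by the Tarski–Vaught test. -/
theorem exists_elementarySubstructure {M : Set ℭ}
    (h : ∀ A ⊆ M, A.Finite → ∀ c, ∃ b ∈ M, Conj L A c b) :
    ∃ N : L.ElementarySubstructure ℭ, (N : Set ℭ) = M := by
  let S : L.Substructure ℭ :=
    { carrier := M
      fun_mem := fun {n} F x hx => by
        obtain ⟨b, hb, σ, hσ, rfl⟩ := h (Set.range x) (Set.range_subset_iff.2 hx)
          (Set.finite_range x) (Structure.funMap F x)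
        rwa [σ.map_fun, show (σ ∘ x) = x from funext fun i => hσ _ ⟨i, rfl⟩] at hb }
  refine ⟨S.toElementarySubstructure fun n φ x a hφ => ?_, rfl⟩
  obtain ⟨b, hb, σ, hσ, rfl⟩ := h (Set.range fun i => (x i : ℭ))
    (Set.range_subset_iff.2 fun i => (x i).2) (Set.finite_range _) a
  refine ⟨⟨σ a, hb⟩, ?_⟩
  rw [← StrongHomClass.realize_boundedFormula σ φ] at hφ
  rw [Fin.comp_snoc, Unique.eq_default (σ ∘ default)] at hφ
  convert hφ using 2
  exact funext fun i => (hσ _ ⟨i, rfl⟩).symm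

/-- A family of fewer elements than the cofinality of a linear order has a strict upper bound. -/
theorem exists_forall_lt_of_mk_lt_cof {I : Type w} [LinearOrder I] {α : Type w} (f : α → I)
    (h : #α < Order.cof I) : ∃ j, ∀ a, f a < j := by
  by_contra! hf
  refine h.not_ge ((Order.cof_le (s := Set.range f) fun j => ?_).trans mk_range_le)
  obtain ⟨a, ha⟩ := hf j
  exact ⟨f a, ⟨a, rfl⟩, ha⟩

section Chain

variable [Nonempty ℭ] {T : L.Theory} {μ : Cardinal.{w}} {Ind : Set ℭ → Set ℭ → Set ℭ → Prop}

/-- The chain whose union is a lovely pair. Each stage has a later stage in which the density and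
extension conditions hold for parameters in the former, and the predicates grow independently.
All stages stay within `2 ^ ν`, and the cofinality of the chain exceeds `κ`. -/
theorem IsIndependenceRelation.exists_chain (hI : IsIndependenceRelation L μ Ind)
    (hM : IsMonster T μ ℭ) {ν κ : Cardinal.{w}}
    (hν : max ℵ₀ (Cardinal.lift.{w} L.card) ≤ Cardinal.lift.{max u v} ν)
    (hκ0 : ℵ₀ ≤ κ) (hκν : κ ≤ ν) (hνμ : 2 ^ ν < μ) {C PC : Set ℭ} (hC : #C ≤ 2 ^ ν)
    (hPC : PC ⊆ C) :
    ∃ (I : Type w) (_ : LinearOrder I) (M P : I → Set ℭ),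
      #I ≤ 2 ^ ν ∧ κ < Order.cof I ∧ Monotone M ∧ Monotone P ∧
      (∀ i, P i ⊆ M i) ∧ (∀ i, #(M i) ≤ 2 ^ ν) ∧
      (∃ i₀, M i₀ = C ∧ P i₀ = PC) ∧
      (∀ i j, i ≤ j → Ind (P j) (P i) (M i)) ∧
      ∀ i, ∃ j, i ≤ j ∧
        (∀ A ⊆ M i, #A ≤ κ → ∀ c, Ind {c} (P i ∩ A) A → ∃ b ∈ P j, Conj L A c b) ∧
        (∀ A ⊆ M i, #A ≤ κ → ∀ c, ∃ b ∈ M j, Conj L A c b ∧ Ind {b} A (M i ∪ P j)) := by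
  have hμ := hM.isStrongLimit.aleph0_le
  have hν0 : ℵ₀ ≤ ν := hκ0.trans hκν
  have hθ0 : ℵ₀ ≤ (2 : Cardinal.{w}) ^ ν := hν0.trans (cantor ν).le
  -- The step is made total, as a function of arbitrary pairs, so that it can be iterated.
  -- The step is made total, as a function of arbitrary pairs, so that it can be iterated.
  -- The step is made total, as a function of arbitrary pairs, so that it can be iterated.
  have hstep : ∀ X : Set ℭ × Set ℭ, ∃ Y : Set ℭ × Set ℭ, X.2 ⊆ X.1 → #X.1 ≤ 2 ^ ν →
      X.1 ⊆ Y.1 ∧ X.2 ⊆ Y.2 ∧ Y.2 ⊆ Y.1 ∧ #Y.1 ≤ 2 ^ ν ∧ Ind Y.2 X.2 X.1 ∧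
      (∀ A ⊆ X.1, #A ≤ κ → ∀ c, Ind {c} (X.2 ∩ A) A → ∃ b ∈ Y.2, Conj L A c b) ∧
      (∀ A ⊆ X.1, #A ≤ κ → ∀ c, ∃ b ∈ Y.1, Conj L A c b ∧ Ind {b} A (X.1 ∪ Y.2)) := by
    intro X
    by_cases h : X.2 ⊆ X.1 ∧ #X.1 ≤ 2 ^ ν
    · obtain ⟨M', P', h'⟩ := hI.exists_step hM hν hκν hνμ h.1 h.2
      exact ⟨(M', P'), fun _ _ => h'⟩
    · exact ⟨X, fun h1 h2 => absurd ⟨h1, h2⟩ h⟩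
  choose S hS using hstep
  let I : Type w := (Order.succ κ).ord.ToType
  have hwf : WellFoundedLT I := inferInstance
  have hIcard : #I ≤ 2 ^ ν := by
    rw [mk_toType, card_ord]
    exact (Order.succ_le_of_lt (cantor κ)).trans (power_le_power_left two_ne_zero hκν)
  have hIcof : κ < Order.cof I := by
    rw [Ordinal.cof_toType, (isRegular_succ hκ0).cof_ord]
    exact Order.lt_succ κ
  -- The stage `i` of the chain collects `(C, PC)` and the steps performed at all earlier stages.
  let F : (i : I) → ((j : I) → j < i → Set ℭ × Set ℭ) → Set ℭ × Set ℭ := fun i rec =>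
    (C ∪ ⋃ j : Set.Iio i, (S (rec j j.2)).1, PC ∪ ⋃ j : Set.Iio i, (S (rec j j.2)).2)
  obtain ⟨X, hX⟩ : ∃ X : I → Set ℭ × Set ℭ, ∀ i, X i =
      (C ∪ ⋃ j : Set.Iio i, (S (X j)).1, PC ∪ ⋃ j : Set.Iio i, (S (X j)).2) :=
    ⟨wellFounded_lt.fix F, fun i => wellFounded_lt.fix_eq F i⟩
  have hX1 : ∀ i, (X i).1 = C ∪ ⋃ j : Set.Iio i, (S (X j)).1 := fun i => congrArg Prod.fst (hX i)
  have hX2 : ∀ i, (X i).2 = PC ∪ ⋃ j : Set.Iio i, (S (X j)).2 := fun i => congrArg Prod.snd (hX i)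
  have hgood : ∀ i, (X i).2 ⊆ (X i).1 ∧ #(X i).1 ≤ 2 ^ ν := fun i => by
    induction i using WellFoundedLT.induction with
    | ind i ih =>
      constructor
      · rw [hX1, hX2]
        exact Set.union_subset_union hPC (Set.iUnion_mono fun j =>
          (hS _ (ih j j.2).1 (ih j j.2).2).2.2.1)
      · rw [hX1]
        refine (mk_union_le _ _).trans (add_le_of_le hθ0 ?_ ?_)
        · exact hC
        · refine (mk_iUnion_le_sum_mk).trans ((sum_le_sum _ (fun _ => 2 ^ ν) fun j : Set.Iio i =>
            (hS _ (ih j j.2).1 (ih j j.2).2).2.2.2.1).trans ?_)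
          rw [sum_const']
          exact (mul_le_mul' ((mk_set_le _).trans hIcard) le_rfl).trans (mul_eq_self hθ0).le
  have hS' := fun i => hS _ (hgood i).1 (hgood i).2
  have hX1s : ∀ i, IsSmall μ (X i).1 := fun i => (hgood i).2.trans_lt hνμ
  have hX2s : ∀ i, IsSmall μ (X i).2 := fun i => (hX1s i).mono (hgood i).1
  have hS1s : ∀ i, IsSmall μ (S (X i)).1 := fun i => (hS' i).2.2.2.1.trans_lt hνμ
  have hS2s : ∀ i, IsSmall μ (S (X i)).2 := fun i => (hS1s i).mono (hS' i).2.2.1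
  have hlt1 : ∀ {j i}, j < i → (S (X j)).1 ⊆ (X i).1 := fun {j i} hji => by
    rw [hX1 i]
    exact (Set.subset_iUnion (fun j : Set.Iio i => (S (X j)).1) ⟨j, hji⟩).trans
      Set.subset_union_right
  have hlt2 : ∀ {j i}, j < i → (S (X j)).2 ⊆ (X i).2 := fun {j i} hji => by
    rw [hX2 i]
    exact (Set.subset_iUnion (fun j : Set.Iio i => (S (X j)).2) ⟨j, hji⟩).trans
      Set.subset_union_right
  have hmono1 : ∀ {j i}, j ≤ i → (X j).1 ⊆ (X i).1 := fun {j i} hji => by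
    rcases hji.eq_or_lt with rfl | h
    · exact subset_rfl
    · exact (hS' j).1.trans (hlt1 h)
  have hmono2 : ∀ {j i}, j ≤ i → (X j).2 ⊆ (X i).2 := fun {j i} hji => by
    rcases hji.eq_or_lt with rfl | h
    · exact subset_rfl
    · exact (hS' j).2.1.trans (hlt2 h)
  have hSmono2 : ∀ {j i}, j ≤ i → (S (X j)).2 ⊆ (S (X i)).2 := fun {j i} hji => by
    rcases hji.eq_or_lt with rfl | h
    · exact subset_rfl
    · exact (hlt2 h).trans (hS' i).2.1
  have hnonempty : Nonempty I := by
    rw [← Order.cof_ne_zero_iff]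
    exact ((aleph0_pos.trans_le hκ0).trans hIcof).ne'
  have hind : ∀ i j, i ≤ j → Ind (X j).2 (X i).2 (X i).1 := fun i j => by
    induction j using WellFoundedLT.induction with
    | ind j ih =>
      intro hij
      rcases hij.eq_or_lt with rfl | hlt
      · exact hI.symmetry _ _ _ (hX1s i) (hX2s i) (hX2s i)
          (hI.existence hM (hX1s i) (hX2s i))
      · refine (hI.finite_character _ _ _ (hX2s j) (hX2s i) (hX1s i)).2 fun A₀ hA₀ hfin => ?_
                    -- A finite subset of the predicate at a later stage lies in a single earlier step.
        have hk : ∃ k, k < j ∧ i ≤ k ∧ A₀ ⊆ (S (X k)).2 := by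
          induction A₀, hfin using Set.Finite.induction_on with
          | empty => exact ⟨i, hlt, le_rfl, Set.empty_subset _⟩
          | @insert a A₁ _ _ ih' =>
            obtain ⟨k, hkj, hik, hk⟩ := ih' ((Set.subset_insert _ _).trans hA₀)
            have ha := hA₀ (Set.mem_insert _ _)
            rw [hX2] at ha
            rcases ha with ha | ha
            · refine ⟨k, hkj, hik, Set.insert_subset ((hS' k).2.1 ?_) hk⟩
              rw [hX2]
              exact .inl ha
            · obtain ⟨⟨k', hk'⟩, ha⟩ := Set.mem_iUnion.1 ha
              exact ⟨max k k', max_lt hkj hk', hik.trans (le_max_left _ _),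
                Set.insert_subset (hSmono2 (le_max_right _ _) ha)
                  (hk.trans (hSmono2 (le_max_left _ _)))⟩
        obtain ⟨k, hkj, hik, hk⟩ := hk
        refine hI.mono_left (hS2s k) (hX2s i) (hX1s i) ?_ hk
        -- Transitivity along `P (X i) ⊆ P (X k) ⊆ P (S (X k))`, where `P` is the second component.
        -- Transitivity along `P (X i) ⊆ P (X k) ⊆ P (S (X k))`, where `P` is the second component.
        -- Transitivity along `P (X i) ⊆ P (X k) ⊆ P (S (X k))`, where `P` is the second component.
        have h1 := hI.symmetry _ _ _ (hX2s k) (hX2s i) (hX1s i) (ih k hkj hik)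
        have h2 := hI.mono_right (hS2s k) (hX2s k) (hX1s k) (hS' k).2.2.2.2.1 (hmono1 hik)
        have h3 := hI.symmetry _ _ _ (hS2s k) (hX2s k) (hX1s i) h2
        refine hI.symmetry _ _ _ (hX1s i) (hX2s i) (hS2s k) ?_
        exact hI.mono_right (hX1s i) (hX2s i) ((hX2s k).union hμ (hS2s k))
          (hI.trans hμ (hX1s i) (hX2s i) (hX2s k) (hS2s k) h1
            (by rwa [Set.union_eq_self_of_subset_left (hmono2 hik)])) Set.subset_union_right
  refine ⟨I, inferInstance, fun i => (X i).1, fun i => (X i).2, hIcard, hIcof,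
    fun _ _ => hmono1, fun _ _ => hmono2, fun i => (hgood i).1, fun i => (hgood i).2, ?_, hind,
    fun i => ?_⟩
  · obtain ⟨i₀, -, hi₀⟩ := hwf.wf.has_min (Set.univ : Set I) Set.univ_nonempty
    have : IsEmpty (Set.Iio i₀) := ⟨fun j => hi₀ j trivial j.2⟩
    exact ⟨i₀, by simp [hX1], by simp [hX2]⟩
  · -- The stage at the successor `j` of `i` is the step performed at `i`.
    obtain ⟨j, hij, hj⟩ := hwf.wf.has_min {j | i < j} <| by
      obtain ⟨j, hj⟩ := exists_forall_lt_of_mk_lt_cof (fun _ : PUnit => i)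
        (by simpa using (one_le_aleph0.trans hκ0).trans_lt hIcof)
      exact ⟨j, hj ⟨⟩⟩
    have hji : ∀ k, k < j → k ≤ i := fun k hk => not_lt.1 fun h => hj k h hk
    have hSj : (X j).2 = (S (X i)).2 := by
      refine Set.Subset.antisymm ?_ (hlt2 hij)
      rw [hX2 j]
      refine Set.union_subset ?_ (Set.iUnion_subset fun k => hSmono2 (hji k k.2))
      refine Set.Subset.trans ?_ (hS' i).2.1
      rw [hX2]
      exact Set.subset_union_left
    refine ⟨j, hij.le, ?_, fun A hA hAκ c => ?_⟩
    · dsimp only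
      rw [hSj]
      exact (hS' i).2.2.2.2.2.1
    · obtain ⟨b, hb, h⟩ := (hS' i).2.2.2.2.2.2 A hA hAκ c
      exact ⟨b, hlt1 hij hb, by dsimp only; rwa [hSj]⟩

/-- Every small pair `PC ⊆ C` is contained in a lovely pair whose predicate is independent
from `C` over `PC`. -/
theorem IsIndependenceRelation.exists_isLovelyPair (hI : IsIndependenceRelation L μ Ind)
    (hM : IsMonster T μ ℭ) {κ : Cardinal.{w}} (hκμ : κ < μ) {C PC : Set ℭ} (hC : IsSmall μ C)
    (hPC : PC ⊆ C) :
    ∃ (M : L.ElementarySubstructure ℭ) (P : Set ℭ), IsLovelyPair T μ Ind κ M P ∧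
      C ⊆ (M : Set ℭ) ∧ PC ⊆ P ∧ Ind P PC C := by
  have hμ := hM.isStrongLimit.aleph0_le
  obtain ⟨l, hlμ, hl⟩ := Cardinal.lt_lift_iff.1 hM.card_lt
  -- The bound `2 ^ ν` is closed under powers with exponent `κ`, so that the whole chain can stay
  -- within it. Iterated exponentials along the chain could exceed `μ` when `μ` is singular.
  set ν : Cardinal.{w} := max l (max κ #C)
  have hν : max ℵ₀ (Cardinal.lift.{w} L.card) ≤ Cardinal.lift.{max u v} ν := by
    rw [← hl]
    exact Cardinal.lift_le.2 (le_max_left _ _)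
  have hν0 : ℵ₀ ≤ ν := by simpa using (le_max_left _ _).trans hν
  have hθ0 : ℵ₀ ≤ (2 : Cardinal.{w}) ^ ν := hν0.trans (cantor ν).le
  have hνμ : 2 ^ ν < μ := hM.isStrongLimit.isStrongPrelimit (max_lt hlμ (max_lt hκμ hC))
  have hCν : #C ≤ 2 ^ ν := ((le_max_right _ _).trans (le_max_right _ _)).trans (cantor ν).le
  set κ' : Cardinal.{w} := max κ ℵ₀
  have hκ'0 : ℵ₀ ≤ κ' := le_max_right _ _
  have hκ'ν : κ' ≤ ν := max_le ((le_max_left _ _).trans (le_max_right _ _)) hν0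
  obtain ⟨I, _, X, Y, hIcard, hIcof, hX, hY, hYX, hXν, ⟨i₀, hXi₀, hYi₀⟩, hind, hnext⟩ :=
    hI.exists_chain hM hν hκ'0 hκ'ν hνμ hCν hPC
  have hXs : ∀ i, IsSmall μ (X i) := fun i => (hXν i).trans_lt hνμ
  have hYs : ∀ i, IsSmall μ (Y i) := fun i => (hXs i).mono (hYX i)
  set M : Set ℭ := ⋃ i, X i
  set P : Set ℭ := ⋃ i, Y i
  have hMs : IsSmall μ M := by
    refine (mk_iUnion_le_sum_mk.trans ((sum_le_sum _ (fun _ => 2 ^ ν) hXν).trans ?_)).trans_lt hνμ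
    rw [sum_const']
    exact (mul_le_mul' hIcard le_rfl).trans (mul_eq_self hθ0).le
  have hPM : P ⊆ M := Set.iUnion_mono hYX
  have hPs := hMs.mono hPM
  have hYP : ∀ i, Y i ⊆ P := Set.subset_iUnion Y
  have hXM : ∀ i, X i ⊆ M := Set.subset_iUnion X
  -- Since the cofinality is large, a short subset of the union is contained in some stage.
  have hcatch : ∀ A ⊆ M, #A ≤ κ' → ∃ i, A ⊆ X i ∧ P ∩ A ⊆ Y i := fun A hAM hA => by
    have h1 : ∀ a : A, ∃ i, (a : ℭ) ∈ X i := fun a => Set.mem_iUnion.1 (hAM a.2)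
    have h2 : ∀ a : (P ∩ A : Set ℭ), ∃ i, (a : ℭ) ∈ Y i := fun a => Set.mem_iUnion.1 a.2.1
    choose f hf using h1
    choose g hg using h2
    obtain ⟨i, hi⟩ := exists_forall_lt_of_mk_lt_cof f (hA.trans_lt hIcof)
    obtain ⟨j, hj⟩ := exists_forall_lt_of_mk_lt_cof g
      (((mk_le_mk_of_subset Set.inter_subset_right).trans hA).trans_lt hIcof)
    exact ⟨max i j, fun a ha => hX ((hi ⟨a, ha⟩).le.trans (le_max_left _ _)) (hf ⟨a, ha⟩),
      fun a ha => hY ((hj ⟨a, ha⟩).le.trans (le_max_right _ _)) (hg ⟨a, ha⟩)⟩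
  have hindP : ∀ i, Ind P (Y i) (X i) := fun i => by
    refine (hI.finite_character _ _ _ hPs (hYs i) (hXs i)).2 fun A₀ hA₀ hfin => ?_
    obtain ⟨j, -, hj⟩ := hcatch A₀ (hA₀.trans hPM) (hfin.lt_aleph0.le.trans hκ'0)
    rw [Set.inter_eq_right.2 hA₀] at hj
    exact hI.mono_left (hYs _) (hYs i) (hXs i) (hind i (max i j) (le_max_left _ _))
      (hj.trans (hY (le_max_right _ _)))
  have hdens : ∀ A ⊆ M, #A ≤ κ' → ∀ c, Ind {c} (P ∩ A) A → ∃ b ∈ P, Conj L A c b := by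
    intro A hAM hA c hc
    obtain ⟨i, hi1, hi2⟩ := hcatch A hAM hA
    have hPA : Y i ∩ A = P ∩ A :=
      (Set.inter_subset_inter_left A (hYP i)).antisymm
        (Set.subset_inter hi2 Set.inter_subset_right)
    obtain ⟨j, -, hd, -⟩ := hnext i
    obtain ⟨b, hb, hcb⟩ := hd A hi1 hA c (by rwa [hPA])
    exact ⟨b, hYP j hb, hcb⟩
  have hext : ∀ A ⊆ M, #A ≤ κ' → ∀ c, ∃ b ∈ M, Conj L A c b ∧ Ind {b} A P := by
    intro A hAM hA c
    obtain ⟨i, hi, -⟩ := hcatch A hAM hA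
    have hAs := (hXs i).mono hi
    obtain ⟨j, hij, -, he⟩ := hnext i
    obtain ⟨b, hb, hcb, hbI⟩ := he A hi hA c
    refine ⟨b, hXM j hb, hcb, ?_⟩
    have hbs := isSmall_singleton hμ b
    have hXYs := (hXs i).union hμ (hYs j)
    -- `X i`, `Y j` and `b` lie in the stage `j`, from which `P` is independent over `Y j`.
    have h1 : Ind P (X i ∪ Y j) (X j) := hI.base_mono hμ hPs (hYs j) (hXs j) (hindP j)
      Set.subset_union_right (Set.union_subset_union_left _ (hX hij))
    have h2 : Ind {b} (X i ∪ Y j) P := hI.symmetry _ _ _ hPs hXYs hbs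
      (hI.mono_right hPs hXYs (hXs j) h1 (Set.singleton_subset_iff.2 hb))
    exact hI.mono_right hbs hAs (hXYs.union hμ hPs)
      (hI.trans hμ hbs hAs hXYs hPs hbI
        (by rwa [Set.union_eq_self_of_subset_left (hi.trans Set.subset_union_left)]))
      Set.subset_union_right
  obtain ⟨N, hN⟩ := exists_elementarySubstructure (L := L) (M := M) fun A hAM hA c => by
    obtain ⟨b, hb, hcb, -⟩ := hext A hAM (hA.lt_aleph0.le.trans hκ'0) c
    exact ⟨b, hb, hcb⟩
  have hreal : ∀ {A : Set ℭ}, #A < κ → #A ≤ κ' := fun h => h.le.trans (le_max_left _ _)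
  have hP := hindP i₀
  rw [hXi₀, hYi₀] at hP
  refine ⟨N, P, ⟨hN ▸ hPM, ?_, hN ▸ hMs, ?_, ?_⟩, hN ▸ hXi₀ ▸ hXM i₀, hYi₀ ▸ hYP i₀, hP⟩
  · have := hM.model
    infer_instance
  · intro A hA hAκ q ⟨c, hcq, hc⟩
    obtain ⟨b, hb, hcb⟩ := hdens A (hN ▸ hA) (hreal hAκ) c hc
    exact ⟨b, hb, hcq.of_conj hcb⟩
  · intro A hA hAκ q
    rw [hN] at hA
    obtain ⟨c, hcq⟩ := hM.saturated A (hMs.mono hA) q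
    obtain ⟨b, hb, hcb, hbI⟩ := hext A hA (hreal hAκ) c
    exact ⟨b, by rwa [← SetLike.mem_coe, hN], hcq.of_conj hcb, hbI⟩

end Chain

end LovelyPairs

theorem mainTheorem1 {L : FirstOrder.Language.{u, v}} (T : L.Theory) (hT : T.IsComplete)
    {ℭ : Type w} [L.Structure ℭ] [Nonempty ℭ] (μ : Cardinal.{w})
    (hℭ : LovelyPairs.IsMonster T μ ℭ)
    (Ind : Set ℭ → Set ℭ → Set ℭ → Prop)
    (hInd : LovelyPairs.IsIndependenceRelation L μ Ind)
    (κ : Cardinal.{w}) (hκ₀ : LovelyPairs.kappaZero μ Ind < κ) (hκ : κ < μ) :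
    (∃ (M : L.ElementarySubstructure ℭ) (P : Set ℭ), LovelyPairs.IsLovelyPair T μ Ind κ M P) ∧
    (∀ C PC : Set ℭ, LovelyPairs.IsSmall μ C → PC ⊆ C → LovelyPairs.IsClosedIn Ind PC C →
      ∃ (M : L.ElementarySubstructure ℭ) (P : Set ℭ),
        LovelyPairs.IsLovelyPair T μ Ind κ M P ∧
        LovelyPairs.IsSubpair C PC (M : Set ℭ) P ∧ Ind P PC C) ∧
    (∀ A B : Set ℭ, LovelyPairs.IsSmall μ A → LovelyPairs.IsSmall μ B →
      ∃ (M : L.ElementarySubstructure ℭ) (P : Set ℭ),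
        LovelyPairs.IsLovelyPair T μ Ind κ M P ∧ Ind P A B ∧ A ⊆ P) := by
  refine ⟨?_, fun C PC hC hPC hcl => ?_, fun A B hA hB => ?_⟩
  · obtain ⟨M, P, h, -⟩ := hInd.exists_isLovelyPair hℭ hκ (C := ∅) (PC := ∅)
      (LovelyPairs.isSmall_of_finite hℭ.isStrongLimit.aleph0_le Set.finite_empty) subset_rfl
    exact ⟨M, P, h⟩
  · obtain ⟨M, P, h, hCM, hPCP, hP⟩ := hInd.exists_isLovelyPair hℭ hκ hC hPC
    refine ⟨M, P, h, ⟨hCM, Set.Subset.antisymm (fun c hc => ?_) (Set.subset_inter hPCP hPC)⟩, hP⟩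
    have hPs := h.small.mono h.pred_subset
    have hPCs := hC.mono hPC
    -- An element of `C` in the predicate is independent from itself over `PC`.
    have hcc : Ind {c} PC {c} := hInd.mono_left hPs hPCs (hC.mono (Set.singleton_subset_iff.2 hc.2))
      (hInd.mono_right hPs hPCs hC hP (Set.singleton_subset_iff.2 hc.2))
      (Set.singleton_subset_iff.2 hc.1)
    rw [← hcl]
    exact ⟨hcc, hc.2⟩
  · have hAB := hA.union hℭ.isStrongLimit.aleph0_le hB
    obtain ⟨M, P, h, -, hAP, hP⟩ := hInd.exists_isLovelyPair hℭ hκ hAB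
      (Set.subset_union_left : A ⊆ A ∪ B)
    exact ⟨M, P, h, hInd.mono_right (h.small.mono h.pred_subset) hA hAB hP
      Set.subset_union_right, hAP⟩
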